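/- Let $\Phi$ be a homogeneous Poisson point process of intensity $\lambda>0$ in $\mathbb R^2$ (the base stations). A user at $\ell_1\in\mathbb R^2$ is served by the point $x_1$ of $\Phi$ closest to $\ell_1$, at distance $R_1$. The user then moves by a vector of length $v\ge 0$ to $\ell_2$, where the displacement may depend on $x_1$ and on additional randomness independent of $\Phi$. Let $\Theta\in[0,\pi]$ be the angle of the displacement relative to $x_1$, oriented so that $|x_1-\ell_2|=\sqrt{R_1^2+v^2+2R_1v\cos\Theta}$ (that is, $\Theta=\pi-\angle(x_1-\ell_1,\ell_2-\ell_1)$). Let $R_2$ be the distance from $\ell_2$ to the closest point of $\Phi$, and let $H$ (handoff) be the event that some point of $\Phi$ is strictly closer to $\ell_2$ than $x_1$. For radii $r,s$ and points at distance $v$ let $|\mathbf C(\ell_1,r,\ell_2,s,v)|$ be the area of the set of points of the closed disc of radius $s$ around $\ell_2$ that are not in the closed disc of radius $r$ around $\ell_1$ (it depends on $\ell_1,\ell_2$ only through $v$). Put $r_{12}=\sqrt{r_1^2+v^2+2r_1v\cos\theta}$ and $z_1=\max(0,r_1-v)$. Then for almost every value $(r_1,\theta)$ of $(R_1,\Theta)$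 with $r_1<v+r_{12}$ (which excludes only $v=0$ and the case $\theta=\pi$, $v\le r_1$, where a handoff has conditional probability zero), the conditional distribution function of $R_2$ given $H$, $R_1=r_1$ and $\Theta=\theta$ is $$F_{R_2\mid H}(r_2\mid H,r_1,\theta)=\begin{cases}0,& r_2<z_1,\\[2pt] \dfrac{1-\exp\left(-\lambda\,|\mathbf C(\ell_1,r_1,\ell_2,r_2,v)|\right)}{1-\exp\left(-\lambda\,|\mathbf C(\ell_1,r_1,\ell_2,r_{12},v)|\right)},& z_1\le r_2\le r_{12},\\[2pt] 1,& r_2>r_{12}.\end{cases}$$ -/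

import Mathlib

open MeasureTheory ProbabilityTheory
open scoped NNReal

/-- The Euclidean plane. -/
abbrev Plane : Type := EuclideanSpace ℝ (Fin 2)

/-- The number `N(B)` of points of the random set `Φ` in `B` (used for bounded `B` only). -/
noncomputable def pointCount {Ω : Type*} (Φ : Ω → Set Plane) (B : Set Plane) (ω : Ω) : ℕ :=
  (Φ ω ∩ B).ncard

/-- `Φ` is a homogeneous Poisson point process of intensity `lam` in the plane: a locally finite
random set whose counts on bounded Borel sets are random variables, Poisson distributed with mean
`lam * |B|`, and independent over disjoint sets. -/
structure IsHomogeneousPPP {Ω : Type*} [MeasurableSpace Ω] (P : Measure Ω) (lam : ℝ≥0)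
    (Φ : Ω → Set Plane) : Prop where
  locallyFinite : ∀ ω B, Bornology.IsBounded B → (Φ ω ∩ B).Finite
  measurable_count : ∀ B, Bornology.IsBounded B → MeasurableSet B → Measurable (pointCount Φ B)
  poisson : ∀ B, Bornology.IsBounded B → MeasurableSet B →
    P.map (pointCount Φ B) = poissonMeasure (lam * (volume B).toNNReal)
  indep : ∀ (n : ℕ) (B : Fin n → Set Plane), (∀ i, Bornology.IsBounded (B i)) →
    (∀ i, MeasurableSet (B i)) → Pairwise (fun i j => Disjoint (B i) (B j)) →
    iIndepFun (fun i => pointCount Φ (B i)) P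

/-- The σ-algebra on `Ω` generated by the point process `Φ`. -/
@[reducible]
noncomputable def pointProcessSigma {Ω : Type*} (Φ : Ω → Set Plane) : MeasurableSpace Ω :=
  ⨆ B ∈ {B : Set Plane | Bornology.IsBounded B ∧ MeasurableSet B},
    MeasurableSpace.comap (pointCount Φ B) inferInstance

/-- `x` is a base station of the configuration `S` that is closest to `l`. -/
def IsClosestBS (S : Set Plane) (l x : Plane) : Prop :=
  x ∈ S ∧ ∀ y ∈ S, dist x l ≤ dist y l

/-- The distance from `l` to the closest base station of the configuration `S`. -/
noncomputable def servingDist (S : Set Plane) (l : Plane) : ℝ :=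
  Metric.infDist l S

/-- The event that some base station is strictly closer to the second location `L₂` than the base
station `X₁` that serves the user at the first location. -/
def handoffEvent {Ω : Type*} (Φ : Ω → Set Plane) (X₁ L₂ : Ω → Plane) : Set Ω :=
  {ω | ∃ y ∈ Φ ω, dist y (L₂ ω) < dist (X₁ ω) (L₂ ω)}

/-- The angle `θ ∈ [0, π]` of the displacement from `l₁` to `l₂` relative to the base station
`x₁`, oriented so that the law of cosines reads `|x₁ - l₂|² = r₁² + v² + 2 r₁ v cos θ`:
`θ = 0` means moving straight away from `x₁`, `θ = π` straight towards it. -/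
noncomputable def displacementAngle (l₁ x₁ l₂ : Plane) : ℝ :=
  Real.pi - InnerProductGeometry.angle (x₁ - l₁) (l₂ - l₁)

/-- The distance `r₁₂` from the second location to the base station serving the first one. -/
noncomputable def oldBSDist (v r₁ θ : ℝ) : ℝ :=
  Real.sqrt (r₁ ^ 2 + v ^ 2 + 2 * r₁ * v * Real.cos θ)

/-- The area of the part of the disc of radius `r₂` around `l₂` that lies outside the disc of
radius `r₁` around `l₁`. -/
noncomputable def crescentArea (l₁ : Plane) (r₁ : ℝ) (l₂ : Plane) (r₂ : ℝ) : ℝ :=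
  volume.real (Metric.closedBall l₂ r₂ \ Metric.closedBall l₁ r₁)

/-- The conditional distribution function, with `v = |l₁ - l₂|`. -/
noncomputable def handoffCDF (lam : ℝ≥0) (v : ℝ) (l₁ l₂ : Plane) (r₁ θ r₂ : ℝ) : ℝ :=
  if r₂ < max 0 (r₁ - v) then 0
  else if r₂ ≤ oldBSDist v r₁ θ then
    (1 - Real.exp (-(lam * crescentArea l₁ r₁ l₂ r₂))) /
      (1 - Real.exp (-(lam * crescentArea l₁ r₁ l₂ (oldBSDist v r₁ θ))))
  else 1

/-! Given the closest point `X₁` and the mark `W`, the other points form a Poisson process outside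
the disc of radius `R₁` around `l₁`. For a level `s ≤ r₁₂` the old station is not in the open disc
of radius `s` around `L₂`, so `R₂ < s` means that the crescent contains a point, which has
conditional probability `1 - exp (-λ |C(s)|)`. By reflection the crescent area sees `L₂` only
through `v`, so the same formula holds given `(R₁, Θ)` alone (`measure_servingDist_lt`). Taking `s =
r₁₂` gives the probability of a handoff, `s = min t r₁₂` that of a handoff with `R₂ < t`, and the
quotient is the claim.

The conditional Poisson property (`measure_closest_void_ball`) is proved with void events only. They
determine the closest point up to null sets, because almost surely no two points are equidistant
from `l₁`. Random crescents are then approximated from inside by countably many deterministic sets.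
`condDistrib_cond_mul_ae_eq` turns the joint laws into a statement on the regular conditional
distribution. -/

open Set Filter Topology

/-! ### Void probabilities, distinct distances, and measurability of the nearest distance. -/

section PoissonProcess

variable {Ω : Type*}

/-- The event that the random set `Φ` has no point in `B`. -/
def voidEvent (Φ : Ω → Set Plane) (B : Set Plane) : Set Ω :=
  {ω | Disjoint (Φ ω) B}

theorem voidEvent_union (Φ : Ω → Set Plane) (B D : Set Plane) :
    voidEvent Φ (B ∪ D) = voidEvent Φ B ∩ voidEvent Φ D := by
  ext ω
  simp [voidEvent, disjoint_union_right]

variable [MeasurableSpace Ω] {P : Measure Ω} {lam : ℝ≥0} {Φ : Ω → Set Plane}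

namespace IsHomogeneousPPP

theorem voidEvent_eq_preimage (hΦ : IsHomogeneousPPP P lam Φ) {B : Set Plane}
    (hB : Bornology.IsBounded B) : voidEvent Φ B = pointCount Φ B ⁻¹' {0} := by
  ext ω
  simp [voidEvent, pointCount, ncard_eq_zero (hΦ.locallyFinite ω B hB),
    disjoint_iff_inter_eq_empty]

theorem measurableSet_voidEvent (hΦ : IsHomogeneousPPP P lam Φ) {B : Set Plane}
    (hB : Bornology.IsBounded B) (hBm : MeasurableSet B) : MeasurableSet (voidEvent Φ B) := by
  rw [hΦ.voidEvent_eq_preimage hB]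
  exact hΦ.measurable_count B hB hBm (measurableSet_singleton 0)

theorem measurableSet_voidEvent_sigma (hΦ : IsHomogeneousPPP P lam Φ) {B : Set Plane}
    (hB : Bornology.IsBounded B) (hBm : MeasurableSet B) :
    MeasurableSet[pointProcessSigma Φ] (voidEvent Φ B) := by
  rw [hΦ.voidEvent_eq_preimage hB]
  have hle : MeasurableSpace.comap (pointCount Φ B) inferInstance ≤ pointProcessSigma Φ :=
    le_iSup₂_of_le B ⟨hB, hBm⟩ le_rfl
  exact hle _ ⟨{0}, measurableSet_singleton 0, rfl⟩

theorem measure_count_eq (hΦ : IsHomogeneousPPP P lam Φ) {B : Set Plane}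
    (hB : Bornology.IsBounded B) (hBm : MeasurableSet B) (k : ℕ) :
    P (pointCount Φ B ⁻¹' {k}) = ENNReal.ofReal
      (Real.exp (-(lam * volume.real B)) * (lam * volume.real B) ^ k / k.factorial) := by
  rw [← Measure.map_apply (hΦ.measurable_count B hB hBm) (measurableSet_singleton k),
    hΦ.poisson B hB hBm, poissonMeasure_singleton]
  simp [Measure.real, ENNReal.toReal]

theorem measure_voidEvent (hΦ : IsHomogeneousPPP P lam Φ) {B : Set Plane}
    (hB : Bornology.IsBounded B) (hBm : MeasurableSet B) :
    P (voidEvent Φ B) = ENNReal.ofReal (Real.exp (-(lam * volume.real B))) := by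
  rw [hΦ.voidEvent_eq_preimage hB, hΦ.measure_count_eq hB hBm]
  simp

/-- With mean `m`, the probability `1 - exp (-m) * (1 + m)` is at most `m ^ 2` because `exp (-m) ≥ 1
- m`. The second order in `m` is what makes the union bound over thin annuli vanish. -/
theorem measure_two_le_count (hΦ : IsHomogeneousPPP P lam Φ) [IsProbabilityMeasure P]
    {B : Set Plane} (hB : Bornology.IsBounded B) (hBm : MeasurableSet B) :
    P {ω | 2 ≤ pointCount Φ B ω} ≤ ENNReal.ofReal ((lam * volume.real B) ^ 2) := by
  have hmeas := hΦ.measurable_count B hB hBm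
  set m : ℝ := lam * volume.real B with hm
  have hm0 : 0 ≤ m := by positivity
  have hcompl : {ω | 2 ≤ pointCount Φ B ω} =
      (pointCount Φ B ⁻¹' {0} ∪ pointCount Φ B ⁻¹' {1})ᶜ := by
    ext ω
    simp
    omega
  have hunion : P (pointCount Φ B ⁻¹' {0} ∪ pointCount Φ B ⁻¹' {1}) =
      ENNReal.ofReal (Real.exp (-m) * (1 + m)) := by
    rw [measure_union _ (hmeas (measurableSet_singleton 1)), hΦ.measure_count_eq hB hBm,
      hΦ.measure_count_eq hB hBm, ← hm, ← ENNReal.ofReal_add (by positivity) (by positivity)]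
    · congr 1
      simp
      ring
    · exact Disjoint.preimage _ (by simp)
  rw [hcompl, prob_compl_eq_one_sub ((hmeas (measurableSet_singleton 0)).union
    (hmeas (measurableSet_singleton 1))), hunion, ← ENNReal.ofReal_one,
    ← ENNReal.ofReal_sub _ (by positivity)]
  apply ENNReal.ofReal_le_ofReal
  have := Real.add_one_le_exp (-m)
  nlinarith

end IsHomogeneousPPP

theorem volume_real_ball_sqrt (l : Plane) {x : ℝ} (hx : 0 ≤ x) :
    volume.real (Metric.ball l (Real.sqrt x)) = Real.pi * x := by
  rw [Measure.real, InnerProductSpace.volume_ball_of_dim_even (k := 1) (by simp)]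
  simp [ENNReal.toReal_ofReal, Real.sqrt_nonneg, Real.pi_nonneg, Real.sq_sqrt hx]
  ring

/-- The annulus of points whose squared distance to `l` lies in `[a, b)`. -/
def annulus (l : Plane) (a b : ℝ) : Set Plane :=
  Metric.ball l (Real.sqrt b) \ Metric.ball l (Real.sqrt a)

theorem mem_annulus {l y : Plane} {a b : ℝ} :
    y ∈ annulus l a b ↔ a ≤ dist y l ^ 2 ∧ dist y l ^ 2 < b := by
  simp only [annulus, Set.mem_sdiff, Metric.mem_ball, not_lt]
  rw [Real.lt_sqrt dist_nonneg, Real.sqrt_le_left dist_nonneg]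
  tauto

/-- Area is linear in the squared radius, so equal steps in squared distance cut a disc into annuli
of equal area. -/
theorem volume_real_annulus (l : Plane) {a b : ℝ} (ha : 0 ≤ a) (hab : a ≤ b) :
    volume.real (annulus l a b) = Real.pi * (b - a) := by
  rw [annulus, measureReal_sdiff (Metric.ball_subset_ball (Real.sqrt_le_sqrt hab))
    measurableSet_ball, volume_real_ball_sqrt l ha, volume_real_ball_sqrt l (ha.trans hab)]
  ring

namespace IsHomogeneousPPP

/-- Two equidistant points share an annulus. With `n + 1` annuli of area `π A / (n + 1)`, the union
bound is of order `1 / (n + 1)`. Only outer measure is used, so the bad set need not be measurable.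
-/
theorem ae_dist_injOn_lt (hΦ : IsHomogeneousPPP P lam Φ) [IsProbabilityMeasure P] (l : Plane)
    (A : ℕ) : ∀ᵐ ω ∂P, InjOn (fun y => dist y l) (Φ ω ∩ {y | dist y l ^ 2 < A}) := by
  rw [ae_iff]
  set bad := {ω | ¬ InjOn (fun y => dist y l) (Φ ω ∩ {y | dist y l ^ 2 < A})}
  have hbound : ∀ n : ℕ, P bad ≤ ENNReal.ofReal ((lam * Real.pi * A) ^ 2 * (1 / ((n : ℝ) + 1))) := by
    intro n
    set h : ℝ := A / ((n : ℝ) + 1) with hh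
    have h0 : 0 ≤ h := by positivity
    have hsub : bad ⊆ ⋃ k ∈ Finset.range (n + 1),
        {ω | 2 ≤ pointCount Φ (annulus l (k * h) ((k + 1) * h)) ω} := by
      intro ω hω
      simp only [bad, mem_ofPred_eq, InjOn, not_forall] at hω
      obtain ⟨y, ⟨hy, hyA⟩, z, ⟨hz, -⟩, hyz, hne⟩ := hω
      simp only [mem_ofPred_eq] at hyA
      have hA : 0 < (A : ℝ) := lt_of_le_of_lt (by positivity) hyA
      have hpos : 0 < h := by positivity
      have hk1 := Nat.floor_le (a := dist y l ^ 2 / h) (by positivity)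
      have hk2 := Nat.lt_floor_add_one (dist y l ^ 2 / h)
      set k := ⌊dist y l ^ 2 / h⌋₊
      rw [le_div_iff₀ hpos] at hk1
      rw [div_lt_iff₀ hpos] at hk2
      have hkn : k < n + 1 := by
        have : (k : ℝ) * h < (n + 1) * h := by
          refine hk1.trans_lt (hyA.trans_eq ?_)
          rw [hh]
          field_simp
        exact_mod_cast lt_of_mul_lt_mul_right this h0
      simp only [mem_iUnion, Finset.mem_range, mem_ofPred_eq]
      refine ⟨k, hkn, ?_⟩
      have hfin := hΦ.locallyFinite ω (annulus l (k * h) ((k + 1) * h))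
        (Metric.isBounded_ball.subset sdiff_subset)
      have hyz' : dist y l = dist z l := hyz
      rw [pointCount, Nat.succ_le_iff, one_lt_ncard hfin]
      exact ⟨y, ⟨hy, mem_annulus.2 ⟨hk1, hk2⟩⟩, z,
        ⟨hz, mem_annulus.2 ⟨hyz' ▸ hk1, hyz' ▸ hk2⟩⟩, hne⟩
    calc P bad ≤ ∑ k ∈ Finset.range (n + 1),
          P {ω | 2 ≤ pointCount Φ (annulus l (k * h) ((k + 1) * h)) ω} :=
          (measure_mono hsub).trans (measure_biUnion_finset_le _ _)
      _ ≤ ∑ k ∈ Finset.range (n + 1), ENNReal.ofReal ((lam * (Real.pi * h)) ^ 2) := by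
          gcongr with k
          have := hΦ.measure_two_le_count (B := annulus l (k * h) ((k + 1) * h))
            (Metric.isBounded_ball.subset sdiff_subset) (measurableSet_ball.diff measurableSet_ball)
          rwa [volume_real_annulus l (by positivity) (by nlinarith),
            show ((k : ℝ) + 1) * h - k * h = h by ring] at this
      _ = ENNReal.ofReal ((lam * Real.pi * A) ^ 2 * (1 / ((n : ℝ) + 1))) := by
          rw [Finset.sum_const, Finset.card_range, ← ENNReal.ofReal_nsmul]
          congr 1
          rw [hh]
          simp only [nsmul_eq_mul]
          push_cast
          field_simp
  have hlim : Tendsto (fun n : ℕ => ENNReal.ofReal ((lam * Real.pi * A) ^ 2 * (1 / ((n : ℝ) + 1))))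
      atTop (𝓝 0) := by
    have := (tendsto_one_div_add_atTop_nhds_zero_nat (𝕜 := ℝ)).const_mul ((lam * Real.pi * A) ^ 2)
    simpa using ENNReal.tendsto_ofReal this
  exact le_antisymm (ge_of_tendsto' hlim hbound) zero_le

/-- Almost surely no two points of a Poisson process have the same distance to a given point. -/
theorem ae_dist_injOn (hΦ : IsHomogeneousPPP P lam Φ) [IsProbabilityMeasure P] (l : Plane) :
    ∀ᵐ ω ∂P, InjOn (fun y => dist y l) (Φ ω) := by
  filter_upwards [ae_all_iff.2 (hΦ.ae_dist_injOn_lt l)] with ω hω y hy z hz hyz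
  obtain ⟨A, hA⟩ := exists_nat_gt (dist y l ^ 2)
  have hyz' : dist y l = dist z l := hyz
  exact hω A ⟨hy, hA⟩ ⟨hz, by rwa [mem_ofPred_eq, ← hyz']⟩ hyz

theorem ae_lt_dist_of_isClosestBS (hΦ : IsHomogeneousPPP P lam Φ) [IsProbabilityMeasure P]
    {l : Plane} {X : Ω → Plane} (hX : ∀ᵐ ω ∂P, IsClosestBS (Φ ω) l (X ω)) :
    ∀ᵐ ω ∂P, X ω ∈ Φ ω ∧ ∀ y ∈ Φ ω, y ≠ X ω → dist (X ω) l < dist y l := by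
  filter_upwards [hX, hΦ.ae_dist_injOn l] with ω hω hinj
  exact ⟨hω.1, fun y hy hne => lt_of_le_of_ne (hω.2 y hy) fun h => hne (hinj hy hω.1 h.symm)⟩

theorem measurable_infDist_point (hΦ : IsHomogeneousPPP P lam Φ) (l : Plane) :
    Measurable fun ω => Metric.infDist l (Φ ω) := by
  -- `Metric.infDist` to the empty set is `0`, so empty configurations enter the sublevel sets
  -- separately.
  have hempty : MeasurableSet {ω | Φ ω = ∅} := by
    have : {ω | Φ ω = ∅} = ⋂ n : ℕ, voidEvent Φ (Metric.ball l n) := by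
      ext ω
      simp only [mem_ofPred_eq, voidEvent, mem_iInter]
      refine ⟨fun h n => by simp [h], fun h => eq_empty_iff_forall_notMem.2 fun y hy => ?_⟩
      obtain ⟨n, hn⟩ := exists_nat_gt (dist y l)
      exact disjoint_left.1 (h n) hy hn
    rw [this]
    exact .iInter fun n => hΦ.measurableSet_voidEvent Metric.isBounded_ball measurableSet_ball
  refine measurable_of_Iio fun t => ?_
  have : (fun ω => Metric.infDist l (Φ ω)) ⁻¹' Iio t =
      ({ω | Φ ω = ∅} ∩ {_ω | 0 < t}) ∪ (voidEvent Φ (Metric.ball l t))ᶜ := by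
    ext ω
    simp only [mem_preimage, mem_Iio, mem_union, mem_inter_iff, mem_ofPred_eq, mem_compl_iff,
      voidEvent, not_disjoint_iff]
    rcases eq_empty_or_nonempty (Φ ω) with h | h
    · simp [h]
    · simp [Metric.infDist_lt_iff h, h.ne_empty, dist_comm]
  rw [this]
  exact (hempty.inter (.const _)).union
    (hΦ.measurableSet_voidEvent Metric.isBounded_ball measurableSet_ball).compl

/-- The distance is continuous in the location and measurable in `ω`, hence jointly measurable, and
a random location may be substituted. -/
theorem measurable_infDist (hΦ : IsHomogeneousPPP P lam Φ) {L : Ω → Plane} (hL : Measurable L) :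
    Measurable fun ω => Metric.infDist (L ω) (Φ ω) := by
  have h := measurable_uncurry_of_continuous_of_measurable
    (u := fun (l : Plane) ω => Metric.infDist l (Φ ω))
    (fun ω => Metric.continuous_infDist_pt (Φ ω)) hΦ.measurable_infDist_point
  have hc := h.comp (hL.prodMk measurable_id)
  simpa only [Function.comp_def, Function.uncurry_apply_pair, id] using hc

end IsHomogeneousPPP

end PoissonProcess

/-! ### The strong Markov property at the closest point. -/

section StrongMarkov

variable {Ω S : Type*}

/-- The σ-algebra generated by the void events of `Φ` inside the disc of radius `ρ` around `l`. -/
@[reducible]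
def innerSigma (Φ : Ω → Set Plane) (l : Plane) (ρ : ℝ) : MeasurableSpace Ω :=
  MeasurableSpace.generateFrom
    {E | ∃ B ⊆ Metric.closedBall l ρ, MeasurableSet B ∧ voidEvent Φ B = E}

theorem measurableSet_innerSigma_voidEvent (Φ : Ω → Set Plane) {l : Plane} {ρ : ℝ} {B : Set Plane}
    (hB : B ⊆ Metric.closedBall l ρ) (hBm : MeasurableSet B) :
    MeasurableSet[innerSigma Φ l ρ] (voidEvent Φ B) :=
  MeasurableSpace.measurableSet_generateFrom ⟨B, hB, hBm, rfl⟩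

variable [MeasurableSpace Ω] [MeasurableSpace S] {P : Measure Ω} {lam : ℝ≥0} {Φ : Ω → Set Plane}
  {l : Plane} {ρ : ℝ} {X : Ω → Plane} {W : Ω → S} {D : Set Plane}

namespace IsHomogeneousPPP

theorem innerSigma_le (hΦ : IsHomogeneousPPP P lam Φ) (l : Plane) (ρ : ℝ) :
    innerSigma Φ l ρ ≤ pointProcessSigma Φ := by
  refine MeasurableSpace.generateFrom_le ?_
  rintro _ ⟨B, hB, hBm, rfl⟩
  exact hΦ.measurableSet_voidEvent_sigma (Metric.isBounded_closedBall.subset hB) hBm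

theorem measure_voidEvent_inter (hΦ : IsHomogeneousPPP P lam Φ) {B : Set Plane}
    (hB : Bornology.IsBounded B) (hBm : MeasurableSet B) (hD : Bornology.IsBounded D)
    (hDm : MeasurableSet D) (hBD : Disjoint B D) :
    P (voidEvent Φ B ∩ voidEvent Φ D) = P (voidEvent Φ B) * P (voidEvent Φ D) := by
  rw [← voidEvent_union, hΦ.measure_voidEvent (hB.union hD) (hBm.union hDm),
    hΦ.measure_voidEvent hB hBm, hΦ.measure_voidEvent hD hDm,
    ← ENNReal.ofReal_mul (Real.exp_nonneg _), ← Real.exp_add,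
    measureReal_union hBD hDm hB.measure_lt_top.ne hD.measure_lt_top.ne]
  congr 2
  ring

/-- Events determined by the process inside a disc are independent of void events outside it. -/
theorem measure_inner_inter_voidEvent (hΦ : IsHomogeneousPPP P lam Φ) [IsProbabilityMeasure P]
    (hD : Bornology.IsBounded D) (hDm : MeasurableSet D)
    (hdisj : Disjoint (Metric.closedBall l ρ) D) {G : Set Ω}
    (hG : MeasurableSet[innerSigma Φ l ρ] G) :
    P (G ∩ voidEvent Φ D) = P G * P (voidEvent Φ D) := by
  -- Void events inside the disc form a π-system, since intersecting them corresponds to uniting the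
  -- sets.
  have hindep : Indep (innerSigma Φ l ρ) (MeasurableSpace.generateFrom {voidEvent Φ D}) P := by
    refine IndepSets.indep' ?_ ?_ ?_ (IsPiSystem.singleton _) ?_
    · rintro _ ⟨B, hB, hBm, rfl⟩
      exact hΦ.measurableSet_voidEvent (Metric.isBounded_closedBall.subset hB) hBm
    · rintro _ rfl
      exact hΦ.measurableSet_voidEvent hD hDm
    · rintro _ ⟨B, hB, hBm, rfl⟩ _ ⟨B', hB', hBm', rfl⟩ -
      exact ⟨B ∪ B', union_subset hB hB', hBm.union hBm', voidEvent_union Φ B B'⟩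
    · rw [IndepSets_iff]
      rintro _ _ ⟨B, hB, hBm, rfl⟩ rfl
      exact hΦ.measure_voidEvent_inter (Metric.isBounded_closedBall.subset hB) hBm hD hDm
        (hdisj.mono_left hB)
  exact (Indep_iff _ _ _).1 hindep _ _ hG
    (MeasurableSpace.measurableSet_generateFrom (mem_singleton _))

end IsHomogeneousPPP

/-- The closest point lies in `B` at distance less than `ρ` exactly when, for some rational `q < ρ`,
the disc of radius `q` has a point in `B` and none outside `B`. Local finiteness provides a `q`
separating the closest point from all others. -/
theorem exists_innerSigma_ae_eq
    (hX : ∀ᵐ ω ∂P, X ω ∈ Φ ω ∧ ∀ y ∈ Φ ω, y ≠ X ω → dist (X ω) l < dist y l)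
    (hfin : ∀ ω B, Bornology.IsBounded B → (Φ ω ∩ B).Finite)
    {B : Set Plane} (hB : MeasurableSet B) (ρ : ℝ) :
    ∃ G, MeasurableSet[innerSigma Φ l ρ] G ∧ X ⁻¹' (B ∩ Metric.ball l ρ) =ᵐ[P] G := by
  refine ⟨⋃ q : ℚ, ⋃ _ : (q : ℝ) < ρ, (voidEvent Φ (B ∩ Metric.closedBall l q))ᶜ ∩
    voidEvent Φ (Metric.closedBall l q \ B), ?_, ?_⟩
  · refine MeasurableSet.iUnion fun q => MeasurableSet.iUnion fun hq => ?_
    have hsub : Metric.closedBall l (q : ℝ) ⊆ Metric.closedBall l ρ :=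
      Metric.closedBall_subset_closedBall hq.le
    exact (measurableSet_innerSigma_voidEvent Φ (inter_subset_right.trans hsub)
      (hB.inter measurableSet_closedBall)).compl.inter
      (measurableSet_innerSigma_voidEvent Φ (sdiff_subset.trans hsub)
      (measurableSet_closedBall.diff hB))
  · rw [eventuallyEq_set]
    filter_upwards [hX] with ω ⟨hmem, hlt⟩
    simp only [mem_preimage, mem_iUnion, mem_inter_iff, mem_compl_iff, voidEvent, mem_ofPred_eq,
      not_disjoint_iff, exists_prop, Metric.mem_ball, Metric.mem_closedBall]
    constructor
    · rintro ⟨hXB, hXρ⟩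
      have hF : ((Φ ω ∩ Metric.closedBall l ρ) \ {X ω}).Finite :=
        (hfin ω _ Metric.isBounded_closedBall).subset sdiff_subset
      obtain ⟨q, hq1, hq2⟩ : ∃ q : ℚ, dist (X ω) l < q ∧ (q : ℝ) < ρ ∧
          ∀ y ∈ (Φ ω ∩ Metric.closedBall l ρ) \ {X ω}, (q : ℝ) < dist y l := by
        have hev : ∀ᶠ t in 𝓝[>] dist (X ω) l, t < ρ ∧
            ∀ y ∈ (Φ ω ∩ Metric.closedBall l ρ) \ {X ω}, t < dist y l := by
          refine nhdsWithin_le_nhds ((eventually_lt_nhds hXρ).and ?_)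
          rw [eventually_all_finite hF]
          exact fun y hy => eventually_lt_nhds (hlt y hy.1.1 hy.2)
        obtain ⟨u, hu, hsub⟩ := (mem_nhdsGT_iff_exists_Ioo_subset' hXρ).1 hev
        obtain ⟨q, hq, hqu⟩ := exists_rat_btwn (show dist (X ω) l < u from hu)
        exact ⟨q, hq, hsub ⟨hq, hqu⟩⟩
      refine ⟨q, hq2.1, ⟨X ω, hmem, hXB, hq1.le⟩, disjoint_left.2 fun y hy hyq => ?_⟩
      by_cases hyX : y = X ω
      · exact hyq.2 (hyX ▸ hXB)
      · have hyq1 : dist y l ≤ q := hyq.1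
        exact (hq2.2 y ⟨⟨hy, hyq1.trans hq2.1.le⟩, hyX⟩).not_ge hyq1
    · rintro ⟨q, hqρ, ⟨y, hy, hyB, hyq⟩, hdisj⟩
      have hXq : dist (X ω) l ≤ q := by
        by_cases hyX : y = X ω
        · exact hyX ▸ hyq
        · exact (hlt y hy hyX).le.trans hyq
      refine ⟨?_, hXq.trans_lt hqρ⟩
      by_contra hXB
      exact disjoint_left.1 hdisj hmem ⟨hXq, hXB⟩

namespace IsHomogeneousPPP

variable [IsProbabilityMeasure P]

/-- On the event that the closest point lies in the disc of radius `ρ`, its position and an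
independent mark are independent of the process outside the disc. -/
theorem measure_closest_inter_voidEvent (hΦ : IsHomogeneousPPP P lam Φ)
    (hXm : Measurable X)
    (hX : ∀ᵐ ω ∂P, X ω ∈ Φ ω ∧ ∀ y ∈ Φ ω, y ≠ X ω → dist (X ω) l < dist y l)
    (hW : Measurable W)
    (hindep : Indep (pointProcessSigma Φ) (MeasurableSpace.comap W inferInstance) P)
    (hD : Bornology.IsBounded D) (hDm : MeasurableSet D)
    (hdisj : Disjoint (Metric.closedBall l ρ) D) {A : Set (Plane × S)} (hA : MeasurableSet A)
    (hAρ : ∀ z ∈ A, dist z.1 l < ρ) :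
    P ((fun ω => (X ω, W ω)) ⁻¹' A ∩ voidEvent Φ D) =
      P ((fun ω => (X ω, W ω)) ⁻¹' A) * P (voidEvent Φ D) := by
  have hZ : Measurable fun ω => (X ω, W ω) := hXm.prodMk hW
  set T : Set (Plane × S) := {z | dist z.1 l < ρ} with hT
  have hTm : MeasurableSet T := measurableSet_lt (by fun_prop) (by fun_prop)
  -- Rectangles suffice. On them the event for `X` is replaced by an inner event `G`, the mark
  -- splits off by `hindep`, and the void event by spatial independence.
  have key : ((P.restrict (voidEvent Φ D)).map fun ω => (X ω, W ω)).restrict T =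
      P (voidEvent Φ D) • (P.map fun ω => (X ω, W ω)).restrict T := by
    refine Measure.ext_prod fun {B C} hB hC => ?_
    have hBC : MeasurableSet (B ×ˢ C ∩ T) := (hB.prod hC).inter hTm
    rw [Measure.restrict_apply (hB.prod hC), Measure.smul_apply, smul_eq_mul,
      Measure.restrict_apply (hB.prod hC), Measure.map_apply hZ hBC, Measure.map_apply hZ hBC,
      Measure.restrict_apply (hZ hBC)]
    obtain ⟨G, hG, hGe⟩ := exists_innerSigma_ae_eq hX hΦ.locallyFinite hB ρ
    have hpre : (fun ω => (X ω, W ω)) ⁻¹' (B ×ˢ C ∩ T) =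
        X ⁻¹' (B ∩ Metric.ball l ρ) ∩ W ⁻¹' C := by
      ext ω
      simp [hT]
      tauto
    have hGs := hΦ.innerSigma_le l ρ G hG
    have hCs : MeasurableSet[MeasurableSpace.comap W inferInstance] (W ⁻¹' C) := ⟨C, hC, rfl⟩
    have hVs := hΦ.measurableSet_voidEvent_sigma hD hDm
    rw [Indep_iff] at hindep
    have h1 : P (X ⁻¹' (B ∩ Metric.ball l ρ) ∩ W ⁻¹' C) = P G * P (W ⁻¹' C) := by
      rw [measure_congr (ae_eq_set_inter hGe (ae_eq_refl (W ⁻¹' C))), hindep _ _ hGs hCs]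
    have h2 : P (X ⁻¹' (B ∩ Metric.ball l ρ) ∩ W ⁻¹' C ∩ voidEvent Φ D) =
        P G * P (voidEvent Φ D) * P (W ⁻¹' C) := by
      rw [measure_congr (ae_eq_set_inter (ae_eq_set_inter hGe (ae_eq_refl (W ⁻¹' C)))
        (ae_eq_refl (voidEvent Φ D))), inter_right_comm, hindep _ _ (MeasurableSet.inter hGs hVs) hCs,
        hΦ.measure_inner_inter_voidEvent hD hDm hdisj hG]
    rw [hpre, h1, h2]
    ring
  have hAT : A ∩ T = A := inter_eq_left.2 hAρ
  have := congrArg (fun μ => μ A) key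
  simp only [Measure.smul_apply, smul_eq_mul] at this
  rw [Measure.restrict_apply hA, Measure.restrict_apply hA, hAT, Measure.map_apply hZ hA,
    Measure.map_apply hZ hA, Measure.restrict_apply (hZ hA)] at this
  rw [this, mul_comm]

/-- Here the void set depends on the closest point and the mark through a countable index. On each
cell it is a fixed set, and the cells are summed. -/
theorem measure_closest_inter_voidEvent_discrete (hΦ : IsHomogeneousPPP P lam Φ)
    (hXm : Measurable X)
    (hX : ∀ᵐ ω ∂P, X ω ∈ Φ ω ∧ ∀ y ∈ Φ ω, y ≠ X ω → dist (X ω) l < dist y l)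
    (hW : Measurable W)
    (hindep : Indep (pointProcessSigma Φ) (MeasurableSpace.comap W inferInstance) P)
    {ι : Type*} [Countable ι] [MeasurableSpace ι] [MeasurableSingletonClass ι]
    {κ : Plane × S → ι} (hκ : Measurable κ) {D : ι → Set Plane} {ρ : ι → ℝ}
    (hD : ∀ i, Bornology.IsBounded (D i)) (hDm : ∀ i, MeasurableSet (D i))
    (hdisj : ∀ i, Disjoint (Metric.closedBall l (ρ i)) (D i))
    (hκρ : ∀ z, dist z.1 l < ρ (κ z)) {A : Set (Plane × S)} (hA : MeasurableSet A) :
    MeasurableSet {ω | (X ω, W ω) ∈ A ∧ Disjoint (Φ ω) (D (κ (X ω, W ω)))} ∧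
    P {ω | (X ω, W ω) ∈ A ∧ Disjoint (Φ ω) (D (κ (X ω, W ω)))} =
      ∫⁻ z in A, ENNReal.ofReal (Real.exp (-(lam * volume.real (D (κ z)))))
        ∂(P.map fun ω => (X ω, W ω)) := by
  have hZ : Measurable fun ω => (X ω, W ω) := hXm.prodMk hW
  have hAi : ∀ i, MeasurableSet (A ∩ κ ⁻¹' {i}) := fun i => hA.inter (hκ (measurableSet_singleton i))
  have hAdisj : Pairwise (Function.onFun Disjoint fun i => A ∩ κ ⁻¹' {i}) := fun i j hij =>
    ((disjoint_singleton.2 hij).preimage κ).mono inter_subset_right inter_subset_right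
  have hset : {ω | (X ω, W ω) ∈ A ∧ Disjoint (Φ ω) (D (κ (X ω, W ω)))} =
      ⋃ i, (fun ω => (X ω, W ω)) ⁻¹' (A ∩ κ ⁻¹' {i}) ∩ voidEvent Φ (D i) := by
    ext ω
    simp [voidEvent, and_assoc]
  have hmeas : ∀ i, MeasurableSet
      ((fun ω => (X ω, W ω)) ⁻¹' (A ∩ κ ⁻¹' {i}) ∩ voidEvent Φ (D i)) := fun i =>
    (hZ (hAi i)).inter (hΦ.measurableSet_voidEvent (hD i) (hDm i))
  have hAU : A = ⋃ i, A ∩ κ ⁻¹' {i} := by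
    ext z
    simp
  rw [hset]
  refine ⟨.iUnion hmeas, ?_⟩
  rw [measure_iUnion (fun i j hij => ((hAdisj hij).preimage _).mono inter_subset_left
    inter_subset_left) hmeas]
  conv_rhs => rw [hAU]
  rw [lintegral_iUnion hAi hAdisj]
  refine tsum_congr fun i => ?_
  rw [hΦ.measure_closest_inter_voidEvent hXm hX hW hindep (hD i) (hDm i) (hdisj i) (hAi i)
    (by rintro z ⟨-, rfl⟩; exact hκρ z), hΦ.measure_voidEvent (hD i) (hDm i),
    setLIntegral_congr_fun (g := fun _ => ENNReal.ofReal (Real.exp (-(lam * volume.real (D i)))))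
      (hAi i) (by rintro z ⟨-, rfl⟩; rfl), setLIntegral_const, Measure.map_apply hZ (hAi i),
    mul_comm]

end IsHomogeneousPPP

theorem exists_measurable_index_dist_lt {T Y : Type*} [MeasurableSpace T] [PseudoMetricSpace Y]
    [MeasurableSpace Y] [OpensMeasurableSpace Y] [TopologicalSpace.SeparableSpace Y] [Nonempty Y]
    {f : T → Y} (hf : Measurable f) {ε : ℝ} (hε : 0 < ε) :
    ∃ κ : T → ℕ, Measurable κ ∧ ∀ z, dist (f z) (TopologicalSpace.denseSeq Y (κ z)) < ε := by
  classical
  have hex : ∀ z, ∃ N, dist (f z) (TopologicalSpace.denseSeq Y N) < ε := fun z =>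
    (TopologicalSpace.denseRange_denseSeq Y).exists_dist_lt (f z) hε
  refine ⟨fun z => Nat.find (hex z), measurable_find hex fun k => ?_, fun z => Nat.find_spec (hex z)⟩
  exact hf (measurableSet_ball (x := TopologicalSpace.denseSeq Y k) (ε := ε))

namespace IsHomogeneousPPP

variable [IsProbabilityMeasure P]

/-- Given the position of the point closest to `l` and an independent mark, the remaining points
form a Poisson process outside the disc: void probabilities of discs whose centre and radius depend
on the closest point and the mark. -/
theorem measure_closest_void_ball (hΦ : IsHomogeneousPPP P lam Φ)
    (hXm : Measurable X)
    (hX : ∀ᵐ ω ∂P, X ω ∈ Φ ω ∧ ∀ y ∈ Φ ω, y ≠ X ω → dist (X ω) l < dist y l)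
    (hW : Measurable W)
    (hindep : Indep (pointProcessSigma Φ) (MeasurableSpace.comap W inferInstance) P)
    {c : Plane × S → Plane} (hc : Measurable c) {s : Plane × S → ℝ} (hs : Measurable s)
    {A : Set (Plane × S)} (hA : MeasurableSet A) :
    P {ω | (X ω, W ω) ∈ A ∧ Disjoint (Φ ω)
        (Metric.ball (c (X ω, W ω)) (s (X ω, W ω)) \ Metric.closedBall l (dist (X ω) l))} =
      ∫⁻ z in A, ENNReal.ofReal (Real.exp (-(lam * volume.real
        (Metric.ball (c z) (s z) \ Metric.closedBall l (dist z.1 l)))))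
        ∂(P.map fun ω => (X ω, W ω)) := by
  set ε : ℕ → ℝ := fun n => 1 / ((n : ℝ) + 1) with hε
  have hεpos : ∀ n, 0 < ε n := fun n => by positivity
  have hεlim : Tendsto ε atTop (𝓝 0) := tendsto_one_div_add_atTop_nhds_zero_nat
  choose k hkm hk using fun n => exists_measurable_index_dist_lt (hc.prodMk hs) (hεpos n)
  set e := TopologicalSpace.denseSeq (Plane × ℝ)
  set κ : ℕ → Plane × S → ℕ × ℕ := fun n z => (k n z, ⌊dist z.1 l / ε n⌋₊) with hκ
  have hκm : ∀ n, Measurable (κ n) := fun n =>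
    (hkm n).prodMk (Nat.measurable_floor.comp (by fun_prop))
  -- Approximation from inside: the excluded radius is rounded up to a grid point strictly above it,
  -- and the ball is shrunk by `2 * ε n`, once for the error in the centre and once for that in the
  -- radius.
  set ρ : ℕ → ℕ × ℕ → ℝ := fun n i => ((i.2 : ℝ) + 1) * ε n with hρ
  set D : ℕ → ℕ × ℕ → Set Plane := fun n i =>
    Metric.ball (e i.1).1 ((e i.1).2 - 2 * ε n) \ Metric.closedBall l (ρ n i) with hD
  have hρlt : ∀ n z, dist z.1 l < ρ n (κ n z) := fun n z => by
    have := Nat.lt_floor_add_one (dist z.1 l / ε n)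
    rwa [div_lt_iff₀ (hεpos n)] at this
  have hρle : ∀ n z, ρ n (κ n z) ≤ dist z.1 l + ε n := fun n z => by
    have := Nat.floor_le (a := dist z.1 l / ε n) (div_nonneg dist_nonneg (hεpos n).le)
    rw [le_div_iff₀ (hεpos n)] at this
    simp only [hρ, hκ]
    linarith
  set K : Plane × S → Set Plane := fun z =>
    Metric.ball (c z) (s z) \ Metric.closedBall l (dist z.1 l) with hK
  have hc1 : ∀ n z, dist (c z) (e (k n z)).1 < ε n := fun n z =>
    (le_max_left _ _).trans_lt (hk n z)
  have hs1 : ∀ n z, |s z - (e (k n z)).2| < ε n := fun n z =>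
    (le_max_right _ _).trans_lt (hk n z)
  have hDK : ∀ n z, D n (κ n z) ⊆ K z := by
    rintro n z y ⟨hy1, hy2⟩
    simp only [Metric.mem_ball, Metric.mem_closedBall, not_le] at hy1 hy2
    have h1 := abs_lt.1 (hs1 n z)
    have h2 := hc1 n z
    have h3 := dist_triangle_right y (c z) (e (k n z)).1
    refine ⟨?_, ?_⟩
    · rw [Metric.mem_ball]
      linarith
    · rw [Metric.mem_closedBall, not_le]
      exact (hρlt n z).trans hy2
  have hKD : ∀ z, ∀ y ∈ K z, ∀ᶠ n in atTop, y ∈ D n (κ n z) := by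
    rintro z y ⟨hy1, hy2⟩
    simp only [Metric.mem_ball, Metric.mem_closedBall, not_le] at hy1 hy2
    -- A quarter of the gap, since the shrinking costs `2 * ε n` and the errors in centre and radius
    -- another `ε n` each.
    have hδ1 : 0 < (s z - dist y (c z)) / 4 := by linarith
    have hδ2 : 0 < dist y l - dist z.1 l := by linarith
    filter_upwards [hεlim.eventually (eventually_lt_nhds hδ1),
      hεlim.eventually (eventually_lt_nhds hδ2)] with n hn1 hn2
    have h1 := abs_lt.1 (hs1 n z)
    have h2 := hc1 n z
    have h3 := dist_triangle y (c z) (e (k n z)).1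
    have h4 := hρle n z
    refine ⟨?_, ?_⟩
    · rw [Metric.mem_ball]
      linarith
    · rw [Metric.mem_closedBall, not_le]
      linarith
  have hDiff : ∀ z y, ∀ᶠ n in atTop, y ∈ D n (κ n z) ↔ y ∈ K z := by
    intro z y
    by_cases hy : y ∈ K z
    · filter_upwards [hKD z y hy] with n hn
      simp [hn, hy]
    · exact .of_forall fun n => ⟨fun h => hDK n z h, fun h => (hy h).elim⟩
  have hDm : ∀ n i, MeasurableSet (D n i) := fun n i =>
    measurableSet_ball.diff measurableSet_closedBall
  have hdisc := fun n => hΦ.measure_closest_inter_voidEvent_discrete hXm hX hW hindep (hκm n)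
    (D := D n) (ρ := ρ n) (fun i => Metric.isBounded_ball.subset sdiff_subset) (hDm n)
    (fun i => disjoint_sdiff_right) (hρlt n) hA
  have hleft : Tendsto (fun n => P {ω | (X ω, W ω) ∈ A ∧ Disjoint (Φ ω) (D n (κ n (X ω, W ω)))})
      atTop (𝓝 (P {ω | (X ω, W ω) ∈ A ∧ Disjoint (Φ ω) (K (X ω, W ω))})) := by
    refine tendsto_measure_of_tendsto_indicator_of_isFiniteMeasure _ P (fun n => (hdisc n).1)
      fun ω => ?_
    by_cases hω : Disjoint (Φ ω) (K (X ω, W ω))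
    · exact .of_forall fun n => and_congr_right fun _ =>
        iff_of_true (hω.mono_right (hDK n _)) hω
    · obtain ⟨y, hy, hyK⟩ := not_disjoint_iff.1 hω
      filter_upwards [hKD _ y hyK] with n hn
      exact and_congr_right fun _ => iff_of_false (not_disjoint_iff.2 ⟨y, hy, hn⟩) hω
  have hright : Tendsto (fun n => ∫⁻ z in A, ENNReal.ofReal
      (Real.exp (-(lam * volume.real (D n (κ n z))))) ∂(P.map fun ω => (X ω, W ω))) atTop
      (𝓝 (∫⁻ z in A, ENNReal.ofReal (Real.exp (-(lam * volume.real (K z))))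
        ∂(P.map fun ω => (X ω, W ω)))) := by
    have hZ : Measurable fun ω => (X ω, W ω) := hXm.prodMk hW
    have : IsProbabilityMeasure (P.map fun ω => (X ω, W ω)) :=
      Measure.isProbabilityMeasure_map hZ.aemeasurable
    refine tendsto_lintegral_of_dominated_convergence (fun _ => 1) (fun n => ?_) (fun n => ?_) ?_ ?_
    · exact (measurable_of_countable fun i =>
        ENNReal.ofReal (Real.exp (-(lam * volume.real (D n i))))).comp (hκm n)
    · refine .of_forall fun z => ?_
      rw [ENNReal.ofReal_le_one, Real.exp_le_one_iff, neg_nonpos]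
      positivity
    · simp
    · refine .of_forall fun z => ?_
      have hvol : Tendsto (fun n => volume (D n (κ n z))) atTop (𝓝 (volume (K z))) :=
        tendsto_measure_of_tendsto_indicator _ (fun n => hDm n _) measurableSet_ball
          (B := Metric.ball (c z) (s z)) measure_ball_lt_top.ne
          (.of_forall fun n => (hDK n z).trans sdiff_subset) (hDiff z)
      have hvolr : Tendsto (fun n => volume.real (D n (κ n z))) atTop (𝓝 (volume.real (K z))) :=
        (ENNReal.tendsto_toReal
          (measure_ne_top_of_subset sdiff_subset measure_ball_lt_top.ne)).comp hvol
      exact ENNReal.tendsto_ofReal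
        ((Real.continuous_exp.tendsto _).comp (hvolr.const_mul _).neg)
  refine tendsto_nhds_unique hleft ?_
  simpa only [(hdisc _).2] using hright

end IsHomogeneousPPP

end StrongMarkov

/-! ### Geometry and regularity of the crescent area. -/

section Crescent

/-- A reflection fixing `l₁` and taking `l₂` to `l₂'` preserves area. This replaces the random
second location by a fixed one. -/
theorem crescentArea_eq_of_dist_eq {l₁ l₂ l₂' : Plane} (h : dist l₁ l₂ = dist l₁ l₂') (r₁ r₂ : ℝ) :
    crescentArea l₁ r₁ l₂ r₂ = crescentArea l₁ r₁ l₂' r₂ := by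
  have hnorm : ‖l₂ - l₁‖ = ‖l₂' - l₁‖ := by
    rw [← dist_eq_norm, ← dist_eq_norm, dist_comm, h, dist_comm]
  set T : Plane ≃ₗᵢ[ℝ] Plane := (ℝ ∙ ((l₂ - l₁) - (l₂' - l₁)))ᗮ.reflection
  have hT : T (l₂ - l₁) = l₂' - l₁ := Submodule.reflection_sub hnorm
  have hmp : MeasurePreserving (fun y => l₁ + T (y - l₁)) volume volume :=
    (measurePreserving_add_left volume l₁).comp
      (T.measurePreserving.comp (measurePreserving_sub_right volume l₁))
  have hdist : ∀ y z, dist (l₁ + T (y - l₁)) (l₁ + T (z - l₁)) = dist y z := fun y z => by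
    rw [dist_add_left, T.dist_map, dist_sub_right]
  have h1 : l₁ + T (l₁ - l₁) = l₁ := by simp
  have h2 : l₁ + T (l₂ - l₁) = l₂' := by simp [hT]
  have hpre : (fun y => l₁ + T (y - l₁)) ⁻¹'
      (Metric.closedBall l₂' r₂ \ Metric.closedBall l₁ r₁) =
      Metric.closedBall l₂ r₂ \ Metric.closedBall l₁ r₁ := by
    ext y
    have e1 := hdist y l₁
    have e2 := hdist y l₂
    rw [h1] at e1
    rw [h2] at e2
    simp only [mem_preimage, Set.mem_sdiff, Metric.mem_closedBall, e1, e2]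
  rw [crescentArea, crescentArea, ← hpre]
  exact hmp.measureReal_preimage
    (measurableSet_closedBall.diff measurableSet_closedBall).nullMeasurableSet

theorem volume_real_ball_diff_closedBall (l₁ l₂ : Plane) (r₁ r₂ : ℝ) :
    volume.real (Metric.ball l₂ r₂ \ Metric.closedBall l₁ r₁) = crescentArea l₁ r₁ l₂ r₂ := by
  have h : (Metric.ball l₂ r₂ : Set Plane) =ᵐ[volume] Metric.closedBall l₂ r₂ :=
    ae_eq_of_subset_of_measure_ge Metric.ball_subset_closedBall
      (Measure.addHaar_closedBall_eq_addHaar_ball volume l₂ r₂).le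
      measurableSet_ball.nullMeasurableSet measure_closedBall_lt_top.ne
  exact measureReal_congr (ae_eq_set_sdiff h (ae_eq_refl (Metric.closedBall l₁ r₁)))

theorem crescentArea_eq_zero {l₁ l₂ : Plane} {r₁ r₂ : ℝ}
    (h : r₂ < max 0 (r₁ - dist l₁ l₂)) : crescentArea l₁ r₁ l₂ r₂ = 0 := by
  rw [crescentArea]
  suffices hs : Metric.closedBall l₂ r₂ \ Metric.closedBall l₁ r₁ = ∅ by simp [hs]
  rw [sdiff_eq_empty]
  rcases lt_max_iff.1 h with h | h
  · simp [Metric.closedBall_eq_empty.2 h]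
  · exact Metric.closedBall_subset_closedBall' (by rw [dist_comm]; linarith)

/-- The open ball minus the closed ball is open. It contains the point at distance `t` beyond `l₂`
on the ray from `l₁`, which is at distance `v + t > r₁` from `l₁`. -/
theorem crescentArea_pos {l₁ l₂ : Plane} {r₁ r₂ : ℝ} (hl : 0 < dist l₁ l₂) (h₂ : 0 < r₂)
    (h : r₁ < dist l₁ l₂ + r₂) : 0 < crescentArea l₁ r₁ l₂ r₂ := by
  rw [← volume_real_ball_diff_closedBall, Measure.real, ENNReal.toReal_pos_iff]
  refine ⟨?_, (measure_mono sdiff_subset).trans_lt measure_ball_lt_top⟩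
  refine (Metric.isOpen_ball.sdiff Metric.isClosed_closedBall).measure_pos volume ?_
  set v := dist l₁ l₂ with hv
  have hm : max 0 (r₁ - v) < r₂ := max_lt h₂ (by linarith)
  set t := (max 0 (r₁ - v) + r₂) / 2 with ht
  have ht0 : 0 ≤ t := by have := le_max_left 0 (r₁ - v); linarith
  have ht1 : r₁ - v < t := by have := le_max_right 0 (r₁ - v); linarith
  have hn : ‖l₂ - l₁‖ = v := by rw [hv, dist_eq_norm, norm_sub_rev]
  refine ⟨l₂ + (t / v) • (l₂ - l₁), ?_, ?_⟩
  · rw [Metric.mem_ball, dist_eq_norm, add_sub_cancel_left, norm_smul, hn, Real.norm_eq_abs,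
      abs_of_nonneg (by positivity), div_mul_cancel₀ _ hl.ne']
    linarith
  · rw [Metric.mem_closedBall, not_le, dist_eq_norm,
      show l₂ + (t / v) • (l₂ - l₁) - l₁ = (1 + t / v) • (l₂ - l₁) by module, norm_smul, hn,
      Real.norm_eq_abs, abs_of_nonneg (by positivity), add_mul, div_mul_cancel₀ _ hl.ne']
    linarith

theorem tendsto_crescentArea_nhdsGT (l₁ l₂ : Plane) (r₁ r : ℝ) :
    Tendsto (fun t => crescentArea l₁ r₁ l₂ t) (𝓝[>] r) (𝓝 (crescentArea l₁ r₁ l₂ r)) := by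
  refine (ENNReal.tendsto_toReal (measure_ne_top_of_subset sdiff_subset
    measure_closedBall_lt_top.ne)).comp ?_
  refine tendsto_measure_of_tendsto_indicator (B := Metric.closedBall l₂ (r + 1)) _
    (fun t => measurableSet_closedBall.diff measurableSet_closedBall) measurableSet_closedBall
    measure_closedBall_lt_top.ne ?_ fun y => ?_
  · filter_upwards [nhdsWithin_le_nhds (eventually_lt_nhds (lt_add_one r))] with t ht
    exact sdiff_subset.trans (Metric.closedBall_subset_closedBall ht.le)
  · by_cases hy : dist y l₂ ≤ r
    · filter_upwards [self_mem_nhdsWithin] with t ht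
      simp [hy, hy.trans (le_of_lt ht)]
    · filter_upwards [nhdsWithin_le_nhds (eventually_lt_nhds (not_le.1 hy))] with t ht
      simp [hy, ht]

theorem tendsto_crescentArea_min_nhdsGT (l₁ l₂ : Plane) (r₁ r R : ℝ) :
    Tendsto (fun t => crescentArea l₁ r₁ l₂ (min t R)) (𝓝[>] r)
      (𝓝 (crescentArea l₁ r₁ l₂ (min r R))) := by
  rcases lt_or_ge r R with h | h
  · rw [min_eq_left h.le]
    refine (tendsto_crescentArea_nhdsGT l₁ l₂ r₁ r).congr' ?_
    filter_upwards [nhdsWithin_le_nhds (eventually_lt_nhds h)] with t ht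
    rw [min_eq_left ht.le]
  · refine tendsto_const_nhds.congr' ?_
    filter_upwards [self_mem_nhdsWithin] with t ht
    rw [min_eq_right h, min_eq_right (h.trans (le_of_lt ht))]

theorem tendsto_measure_Iio_nhdsGT (μ : Measure ℝ) [IsFiniteMeasure μ] (r : ℝ) :
    Tendsto (fun t => μ.real (Iio t)) (𝓝[>] r) (𝓝 (μ.real (Iic r))) := by
  refine (ENNReal.tendsto_toReal (measure_ne_top _ _)).comp ?_
  refine tendsto_measure_of_tendsto_indicator_of_isFiniteMeasure _ μ (fun t => measurableSet_Iio)
    fun y => ?_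
  by_cases hy : y ≤ r
  · filter_upwards [self_mem_nhdsWithin] with t ht
    simp [hy, hy.trans_lt ht]
  · filter_upwards [nhdsWithin_le_nhds (eventually_lt_nhds (not_le.1 hy))] with t ht
    simp [hy, ht.le]

theorem frequently_rat_nhdsGT (r : ℝ) : ∃ᶠ t in 𝓝[>] r, t ∈ range ((↑) : ℚ → ℝ) := by
  intro h
  obtain ⟨u, hu, hsub⟩ := (mem_nhdsGT_iff_exists_Ioo_subset).1 h
  obtain ⟨q, hq⟩ := exists_rat_btwn (show r < u from hu)
  exact hsub hq ⟨q, rfl⟩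

theorem measurable_crescentArea {T : Type*} [MeasurableSpace T] (l₁ l₂ : Plane) {f g : T → ℝ}
    (hf : Measurable f) (hg : Measurable g) :
    Measurable fun p => crescentArea l₁ (f p) l₂ (g p) := by
  refine ENNReal.measurable_toReal.comp (measurable_measure_prodMk_left
    (s := {x : T × Plane | dist x.2 l₂ ≤ g x.1 ∧ ¬ dist x.2 l₁ ≤ f x.1}) ?_)
  have h1 : MeasurableSet {x : T × Plane | dist x.2 l₂ ≤ g x.1} :=
    measurableSet_le (by fun_prop) (by fun_prop)
  have h2 : MeasurableSet {x : T × Plane | dist x.2 l₁ ≤ f x.1} :=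
    measurableSet_le (by fun_prop) (by fun_prop)
  exact h1.inter h2.compl

theorem measurable_oldBSDist (v : ℝ) : Measurable fun p : ℝ × ℝ => oldBSDist v p.1 p.2 := by
  unfold oldBSDist
  fun_prop

theorem abs_sub_le_oldBSDist {v r₁ : ℝ} (hv : 0 ≤ v) (hr : 0 ≤ r₁) (θ : ℝ) :
    |r₁ - v| ≤ oldBSDist v r₁ θ := by
  rw [oldBSDist]
  refine Real.abs_le_sqrt ?_
  have := Real.neg_one_le_cos θ
  nlinarith [mul_nonneg hr hv]

theorem oldBSDist_displacementAngle (l₁ x l₂ : Plane) :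
    oldBSDist (dist l₁ l₂) (dist x l₁) (displacementAngle l₁ x l₂) = dist x l₂ := by
  have h := InnerProductGeometry.norm_sub_sq_eq_norm_sq_add_norm_sq_sub_two_mul_norm_mul_norm_mul_cos_angle
    (x - l₁) (l₂ - l₁)
  rw [sub_sub_sub_cancel_right, ← dist_eq_norm, ← dist_eq_norm, ← dist_eq_norm,
    dist_comm l₂ l₁] at h
  rw [oldBSDist, displacementAngle, Real.cos_pi_sub, ← Real.sqrt_mul_self (dist_nonneg (x := x) (y := l₂)),
    h]
  congr 1
  ring

/-- The truncation `min r₂ r₁₂` merges the three cases: below `z₁` the crescent is empty, and above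
`r₁₂` numerator and denominator agree. -/
theorem handoffCDF_eq {lam : ℝ≥0} {v r₁ θ : ℝ} {l₁ l₂ l₂' : Plane} (hlam : 0 < lam)
    (hr : 0 ≤ r₁) (hl : dist l₁ l₂ = v) (hl' : dist l₁ l₂' = v)
    (h : r₁ < v + oldBSDist v r₁ θ) (r₂ : ℝ) :
    0 < 1 - Real.exp (-(lam * crescentArea l₁ r₁ l₂ (oldBSDist v r₁ θ))) ∧
    handoffCDF lam v l₁ l₂' r₁ θ r₂ =
      (1 - Real.exp (-(lam * crescentArea l₁ r₁ l₂ (min r₂ (oldBSDist v r₁ θ))))) /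
      (1 - Real.exp (-(lam * crescentArea l₁ r₁ l₂ (oldBSDist v r₁ θ)))) := by
  have hv : 0 ≤ v := hl ▸ dist_nonneg
  have habs := abs_le.1 (abs_sub_le_oldBSDist hv hr θ)
  have hv0 : 0 < v := by
    refine lt_of_le_of_ne hv fun h0 => ?_
    rw [← h0] at h
    simp [oldBSDist, Real.sqrt_sq hr] at h
  have hR : 0 < oldBSDist v r₁ θ := by
    by_contra hle
    linarith
  have hpos : 0 < 1 - Real.exp (-(lam * crescentArea l₁ r₁ l₂ (oldBSDist v r₁ θ))) := by
    rw [sub_pos, Real.exp_lt_one_iff, neg_lt_zero]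
    exact mul_pos hlam (crescentArea_pos (hl ▸ hv0) hR (hl ▸ h))
  refine ⟨hpos, ?_⟩
  have hmax : max 0 (r₁ - v) ≤ oldBSDist v r₁ θ := max_le hR.le (by linarith)
  rw [handoffCDF]
  split_ifs with h1 h2
  · rw [min_eq_left (h1.le.trans hmax), crescentArea_eq_zero (hl.symm ▸ h1)]
    simp
  · rw [min_eq_left h2, crescentArea_eq_of_dist_eq (hl'.trans hl.symm),
      crescentArea_eq_of_dist_eq (hl'.trans hl.symm)]
  · rw [min_eq_right (not_le.1 h2).le, div_self hpos.ne']

end Crescent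

/-! ### Joint laws and the conditional distribution given a handoff. -/

section Handoff

theorem measurable_displacementAngle {T : Type*} [MeasurableSpace T] (l₁ : Plane) {x c : T → Plane}
    (hx : Measurable x) (hc : Measurable c) :
    Measurable fun z => displacementAngle l₁ (x z) (c z) := by
  unfold displacementAngle InnerProductGeometry.angle
  exact measurable_const.sub (Real.measurable_arccos.comp
    (((hx.sub_const l₁).inner (hc.sub_const l₁)).div
      ((hx.sub_const l₁).norm.mul (hc.sub_const l₁).norm)))

theorem IsClosestBS.servingDist_eq {S : Set Plane} {l x : Plane} (h : IsClosestBS S l x) :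
    servingDist S l = dist x l := by
  refine le_antisymm ((Metric.infDist_le_dist_of_mem h.1).trans_eq (dist_comm _ _)) ?_
  exact (Metric.le_infDist ⟨x, h.1⟩).2 fun {y} hy => (h.2 y hy).trans_eq (dist_comm _ _)

variable {Ω S : Type*} [MeasurableSpace Ω] [MeasurableSpace S]
  {P : Measure Ω} [IsProbabilityMeasure P]
  {lam : ℝ≥0} {Φ : Ω → Set Plane} {l₁ : Plane} {v : ℝ}
  {X₁ : Ω → Plane} {W : Ω → S} {move : Plane → S → Plane} {L₂ : Ω → Plane} {R₁ R₂ Θ : Ω → ℝ}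

/-- The joint law of the first serving distance, the displacement angle and the event that the
second serving distance is below a level that does not exceed the distance to the old station. -/
theorem measure_servingDist_lt (hΦ : IsHomogeneousPPP P lam Φ)
    (hX₁ : Measurable X₁) (hclosest : ∀ᵐ ω ∂P, IsClosestBS (Φ ω) l₁ (X₁ ω))
    (hW : Measurable W)
    (hindep : Indep (pointProcessSigma Φ) (MeasurableSpace.comap W inferInstance) P)
    (hmove : Measurable (Function.uncurry move)) (hv : ∀ x w, ‖move x w‖ = v)
    (hL₂ : ∀ ω, L₂ ω = l₁ + move (X₁ ω) (W ω))
    (hR₁ : ∀ ω, R₁ ω = servingDist (Φ ω) l₁) (hR₂ : ∀ ω, R₂ ω = servingDist (Φ ω) (L₂ ω))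
    (hΘ : ∀ ω, Θ ω = displacementAngle l₁ (X₁ ω) (L₂ ω))
    (hYm : Measurable fun ω => (R₁ ω, Θ ω)) (hR₂m : Measurable R₂)
    {l₂ : Plane} (hl₂ : dist l₁ l₂ = v)
    {f : ℝ × ℝ → ℝ} (hf : Measurable f) (hfle : ∀ p, f p ≤ oldBSDist v p.1 p.2)
    {A : Set (ℝ × ℝ)} (hA : MeasurableSet A) :
    P ((fun ω => (R₁ ω, Θ ω)) ⁻¹' A ∩ {ω | R₂ ω < f (R₁ ω, Θ ω)}) =
      ∫⁻ p in A, ENNReal.ofReal (1 - Real.exp (-(lam * crescentArea l₁ p.1 l₂ (f p))))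
        ∂(P.map fun ω => (R₁ ω, Θ ω)) := by
  set Z : Ω → Plane × S := fun ω => (X₁ ω, W ω)
  have hZ : Measurable Z := hX₁.prodMk hW
  set c : Plane × S → Plane := fun z => l₁ + move z.1 z.2
  have hc : Measurable c := hmove.const_add l₁
  have hcdist : ∀ z, dist l₁ (c z) = v := fun z => by simp [c, hv]
  set g : Plane × S → ℝ × ℝ := fun z => (dist z.1 l₁, displacementAngle l₁ z.1 (c z))
  have hg : Measurable g :=
    (measurable_fst.dist measurable_const).prodMk (measurable_displacementAngle l₁ measurable_fst hc)
  have hold : ∀ z, oldBSDist v (g z).1 (g z).2 = dist z.1 (c z) := fun z => by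
    rw [← hcdist z]
    exact oldBSDist_displacementAngle l₁ z.1 (c z)
  have hYg : ∀ᵐ ω ∂P, (R₁ ω, Θ ω) = g (Z ω) := by
    filter_upwards [hclosest] with ω hω
    rw [hR₁, hΘ, hω.servingDist_eq, hL₂]
  have hlaw : P.map (fun ω => (R₁ ω, Θ ω)) = (P.map Z).map g := by
    rw [Measure.map_map hg hZ]
    exact Measure.map_congr hYg
  have hX := hΦ.ae_lt_dist_of_isClosestBS hclosest
  have hvoid := hΦ.measure_closest_void_ball hX₁ hX hW hindep hc (hf.comp hg) (hg hA)
  have hcm : Measurable fun p : ℝ × ℝ => crescentArea l₁ p.1 l₂ (f p) :=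
    measurable_crescentArea l₁ l₂ measurable_fst hf
  have hge : P ((fun ω => (R₁ ω, Θ ω)) ⁻¹' A ∩ {ω | R₂ ω < f (R₁ ω, Θ ω)}ᶜ) =
      ∫⁻ p in A, ENNReal.ofReal (Real.exp (-(lam * crescentArea l₁ p.1 l₂ (f p))))
        ∂(P.map fun ω => (R₁ ω, Θ ω)) := by
    rw [hlaw, setLIntegral_map hA (by fun_prop) hg]
    refine Eq.trans (measure_congr ?_) (hvoid.trans ?_)
    · rw [eventuallyEq_set]
      filter_upwards [hX, hYg] with ω ⟨hmem, hlt⟩ hω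
      simp only [mem_inter_iff, mem_preimage, mem_compl_iff, mem_ofPred_eq, hω]
      refine and_congr_right fun _ => ?_
      rw [not_iff_comm, hR₂, servingDist, Metric.infDist_lt_iff ⟨_, hmem⟩, not_disjoint_iff, hL₂]
      refine exists_congr fun y => and_congr_right fun hy => ?_
      simp only [Set.mem_sdiff, Metric.mem_ball, Metric.mem_closedBall, not_le, Function.comp_apply]
      rw [dist_comm (l₁ + move (X₁ ω) (W ω)) y]
      -- A point of the process other than `X₁` is automatically outside the disc around `l₁`. The
      -- point `X₁` itself is ruled out by `f ≤ r₁₂`.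
      refine ⟨fun h => h.1, fun h => ⟨h, hlt y hy ?_⟩⟩
      rintro rfl
      exact absurd (h.trans_le ((hfle _).trans_eq (hold _))) (lt_irrefl _)
    · refine lintegral_congr fun z => ?_
      rw [volume_real_ball_diff_closedBall,
        crescentArea_eq_of_dist_eq ((hcdist z).trans hl₂.symm)]
      rfl
  have hlt_m : MeasurableSet {ω | R₂ ω < f (R₁ ω, Θ ω)} := measurableSet_lt hR₂m (hf.comp hYm)
  have hsplit := measure_inter_add_sdiff (μ := P) ((fun ω => (R₁ ω, Θ ω)) ⁻¹' A) hlt_m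
  rw [sdiff_eq, hge, ← Measure.map_apply hYm hA,
    ← setLIntegral_one A] at hsplit
  have hne : ∫⁻ p in A, ENNReal.ofReal (Real.exp (-(lam * crescentArea l₁ p.1 l₂ (f p))))
        ∂(P.map fun ω => (R₁ ω, Θ ω)) ≠ ⊤ := hge ▸ measure_ne_top _ _
  refine (ENNReal.add_left_inj hne).1 (hsplit.trans ?_)
  rw [← lintegral_add_left (by fun_prop)]
  refine lintegral_congr fun p => ?_
  rw [← ENNReal.ofReal_add _ (Real.exp_nonneg _), sub_add_cancel, ENNReal.ofReal_one]
  rw [sub_nonneg, Real.exp_le_one_iff, neg_nonpos]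
  exact mul_nonneg lam.2 measureReal_nonneg

/-- Multiplying the disintegration under `cond P H` by `P H` removes the normalisation, so `P H = 0`
needs no exclusion. -/
theorem restrict_map_compProd_condDistrib_cond {β : Type*} [MeasurableSpace β] {Y : Ω → β}
    {R : Ω → ℝ} (hR : Measurable R) (H : Set Ω) :
    (P.restrict H).map Y ⊗ₘ condDistrib R Y (cond P H) =
      (P.restrict H).map fun ω => (Y ω, R ω) := by
  rcases eq_or_ne (P H) 0 with h0 | h0
  · simp [Measure.restrict_eq_zero.2 h0]
  · have hP : P.restrict H = P H • cond P H := by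
      rw [ProbabilityTheory.cond, smul_smul, ENNReal.mul_inv_cancel h0 (measure_ne_top _ _), one_smul]
    rw [hP, Measure.map_smul, Measure.map_smul, Measure.compProd_smul_left,
      compProd_map_condDistrib hR.aemeasurable]

/-- On `H` the law of `Y` has density `q`, so both sides have the same integral over every `A`. The
product form avoids dividing where `q` vanishes. -/
theorem condDistrib_cond_mul_ae_eq {β : Type*} [MeasurableSpace β] {Y : Ω → β} {R : Ω → ℝ}
    (hY : Measurable Y) (hR : Measurable R) {H : Set Ω} {s : Set ℝ}
    (hs : MeasurableSet s) {q q' : β → ENNReal} (hq : Measurable q) (hq' : Measurable q')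
    (h : ∀ A, MeasurableSet A → P (Y ⁻¹' A ∩ H) = ∫⁻ p in A, q p ∂(P.map Y))
    (h' : ∀ A, MeasurableSet A → P (Y ⁻¹' A ∩ R ⁻¹' s ∩ H) = ∫⁻ p in A, q' p ∂(P.map Y)) :
    ∀ᵐ p ∂(P.map Y), q p * condDistrib R Y (cond P H) p s = q' p := by
  have : IsProbabilityMeasure (P.map Y) := Measure.isProbabilityMeasure_map hY.aemeasurable
  have hκ : Measurable fun p => condDistrib R Y (cond P H) p s := Kernel.measurable_coe _ hs
  have hdens : (P.restrict H).map Y = (P.map Y).withDensity q := by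
    ext A hA
    rw [Measure.map_apply hY hA, Measure.restrict_apply (hY hA), h A hA, withDensity_apply _ hA]
  refine ae_eq_of_forall_setLIntegral_eq_of_sigmaFinite (hq.mul hκ) hq' fun A hA _ => ?_
  have hcp := congrArg (fun μ => μ (A ×ˢ s))
    (restrict_map_compProd_condDistrib_cond (P := P) (Y := Y) hR H)
  beta_reduce at hcp
  rw [Measure.compProd_apply_prod hA hs, Measure.map_apply (hY.prodMk hR) (hA.prod hs),
    Measure.restrict_apply ((hY.prodMk hR) (hA.prod hs)), hdens,
    setLIntegral_withDensity_eq_setLIntegral_mul _ hq hκ hA] at hcp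
  exact hcp.trans (h' A hA)

end Handoff

/-- The user starts at `l₁`, served by the closest station `X₁`, and is displaced by a vector of
length `v` that may depend on the position of `X₁` and on a random element `W` independent of the
point process. A displacement by a fixed vector, by a fixed angle to `X₁`, or by an independent
uniform angle to `X₁` are special cases. The conclusion is about the regular conditional
distribution of the serving distance at the second location given the serving distance at the
first one and the angle, under the probability measure conditioned on a handoff. The inequality
`p.1 < v + r₁₂` says that a handoff has positive conditional probability; it can fail only if
`v = 0`, or if the angle is exactly `π` and `v ≤ p.1`. -/
theorem lemma2 {Ω S : Type*} [MeasurableSpace Ω] [MeasurableSpace S]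
    (P : Measure Ω) [IsProbabilityMeasure P]
    (lam : ℝ≥0) (hlam : 0 < lam) (Φ : Ω → Set Plane) (hΦ : IsHomogeneousPPP P lam Φ)
    (l₁ : Plane) (v : ℝ)
    (X₁ : Ω → Plane) (hX₁ : Measurable X₁) (hclosest : ∀ᵐ ω ∂P, IsClosestBS (Φ ω) l₁ (X₁ ω))
    (W : Ω → S) (hW : Measurable W)
    (hindep : Indep (pointProcessSigma Φ) (MeasurableSpace.comap W inferInstance) P)
    (move : Plane → S → Plane) (hmove : Measurable (Function.uncurry move))
    (hv : ∀ x w, ‖move x w‖ = v)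
    (L₂ : Ω → Plane) (hL₂ : ∀ ω, L₂ ω = l₁ + move (X₁ ω) (W ω))
    (R₁ R₂ Θ : Ω → ℝ) (hR₁ : ∀ ω, R₁ ω = servingDist (Φ ω) l₁)
    (hR₂ : ∀ ω, R₂ ω = servingDist (Φ ω) (L₂ ω))
    (hΘ : ∀ ω, Θ ω = displacementAngle l₁ (X₁ ω) (L₂ ω)) :
    ∀ᵐ p ∂(P.map fun ω => (R₁ ω, Θ ω)), p.1 < v + oldBSDist v p.1 p.2 →
      ∀ l₂ : Plane, dist l₁ l₂ = v → ∀ r₂ : ℝ,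
        cdf (condDistrib R₂ (fun ω => (R₁ ω, Θ ω)) (cond P (handoffEvent Φ X₁ L₂)) p) r₂ =
          handoffCDF lam v l₁ l₂ p.1 p.2 r₂ := by
  obtain ⟨ω₀⟩ : Nonempty Ω := P.nonempty_of_neZero
  have hL₂dist : ∀ ω, dist l₁ (L₂ ω) = v := fun ω => by simp [hL₂, hv]
  have hL₂m : Measurable L₂ := by
    rw [funext hL₂]
    exact (hmove.comp (hX₁.prodMk hW)).const_add l₁
  have hR₁m : Measurable R₁ := by
    rw [funext hR₁]
    exact hΦ.measurable_infDist_point l₁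
  have hR₂m : Measurable R₂ := by
    rw [funext hR₂]
    exact hΦ.measurable_infDist hL₂m
  have hΘm : Measurable Θ := by
    rw [funext hΘ]
    exact measurable_displacementAngle l₁ hX₁ hL₂m
  have hYm : Measurable fun ω => (R₁ ω, Θ ω) := hR₁m.prodMk hΘm
  set Y : Ω → ℝ × ℝ := fun ω => (R₁ ω, Θ ω) with hYdef
  set H := handoffEvent Φ X₁ L₂
  -- Any point at distance `v` from `l₁` serves as reference location.
  set l := L₂ ω₀
  have hl : dist l₁ l = v := hL₂dist ω₀
  have hold := measurable_oldBSDist v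
  set hit : (ℝ × ℝ → ℝ) → ℝ × ℝ → ℝ := fun f p =>
    1 - Real.exp (-(lam * crescentArea l₁ p.1 l (f p))) with hhit
  have hit_nonneg : ∀ f p, 0 ≤ hit f p := fun f p => by
    simp only [hhit, sub_nonneg, Real.exp_le_one_iff, neg_nonpos]
    exact mul_nonneg lam.2 measureReal_nonneg
  have hit_meas : ∀ {f}, Measurable f → Measurable fun p => ENNReal.ofReal (hit f p) := fun hf =>
    ENNReal.measurable_ofReal.comp (measurable_const.sub (Real.measurable_exp.comp
      ((measurable_crescentArea l₁ l measurable_fst hf).const_mul _).neg))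
  have hformula : ∀ {f : ℝ × ℝ → ℝ}, Measurable f → (∀ p, f p ≤ oldBSDist v p.1 p.2) →
      ∀ A, MeasurableSet A → P (Y ⁻¹' A ∩ {ω | R₂ ω < f (Y ω)}) =
        ∫⁻ p in A, ENNReal.ofReal (hit f p) ∂(P.map Y) := fun hf hfle A hA =>
    measure_servingDist_lt hΦ hX₁ hclosest hW hindep hmove hv hL₂ hR₁ hR₂ hΘ hYm hR₂m hl hf hfle hA
  have hH : ∀ᵐ ω ∂P, ω ∈ H ↔ R₂ ω < oldBSDist v (Y ω).1 (Y ω).2 := by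
    filter_upwards [hclosest] with ω hω
    have hd : oldBSDist v (Y ω).1 (Y ω).2 = dist (X₁ ω) (L₂ ω) := by
      simp only [hYdef]
      rw [hR₁, hΘ, hω.servingDist_eq, ← hL₂dist ω, oldBSDist_displacementAngle]
    rw [hd, hR₂, servingDist, Metric.infDist_lt_iff ⟨_, hω.1⟩]
    simp [H, handoffEvent, dist_comm]
  -- Rational levels keep the exceptional set null. Limits from the right then reach every `r₂` and
  -- turn `Iio` into `Iic`.
  have hrat : ∀ᵐ p ∂(P.map Y), ∀ t : ℚ,
      ENNReal.ofReal (hit (fun p => oldBSDist v p.1 p.2) p) *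
        condDistrib R₂ Y (cond P H) p (Iio (t : ℝ)) =
      ENNReal.ofReal (hit (fun p => min (t : ℝ) (oldBSDist v p.1 p.2)) p) := by
    refine ae_all_iff.2 fun t => condDistrib_cond_mul_ae_eq hYm hR₂m measurableSet_Iio
      (hit_meas hold) (hit_meas (measurable_const.min hold)) (fun A hA => ?_) fun A hA => ?_
    · rw [← hformula hold (fun p => le_rfl) A hA]
      refine measure_congr (eventuallyEq_set.2 ?_)
      filter_upwards [hH] with ω hω
      simp [hω]
    · rw [← hformula (measurable_const.min hold) (fun p => min_le_right _ _) A hA]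
      refine measure_congr (eventuallyEq_set.2 ?_)
      filter_upwards [hH] with ω hω
      simp [hω, and_assoc]
  have hnonneg : ∀ᵐ p ∂(P.map Y), 0 ≤ p.1 := by
    rw [ae_map_iff hYm.aemeasurable (measurableSet_le measurable_const measurable_fst)]
    refine .of_forall fun ω => ?_
    change 0 ≤ R₁ ω
    rw [hR₁]
    exact Metric.infDist_nonneg
  filter_upwards [hrat, hnonneg] with p hp hp0 hgood l₂ hl₂ r₂
  obtain ⟨hpos, hcdf⟩ := handoffCDF_eq hlam hp0 hl hl₂ hgood r₂
  rw [hcdf, cdf_eq_real, eq_div_iff hpos.ne', mul_comm]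
  set κ := condDistrib R₂ Y (cond P H) p
  refine tendsto_nhds_unique_of_frequently_eq ((tendsto_measure_Iio_nhdsGT κ r₂).const_mul _)
    ((Real.continuous_exp.tendsto _).comp ((tendsto_crescentArea_min_nhdsGT l₁ l p.1 r₂
      (oldBSDist v p.1 p.2)).const_mul (lam : ℝ)).neg |>.const_sub 1)
    ((frequently_rat_nhdsGT r₂).mono ?_)
  rintro _ ⟨t, rfl⟩
  have := congrArg ENNReal.toReal (hp t)
  rwa [ENNReal.toReal_mul, ENNReal.toReal_ofReal (hit_nonneg (fun p => oldBSDist v p.1 p.2) p),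
    ENNReal.toReal_ofReal (hit_nonneg (fun p => min (t : ℝ) (oldBSDist v p.1 p.2)) p)] at this
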